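/- Let $\mathcal{C}$ be a modular tensor category over $\mathbb{C}$ (a ribbon fusion category whose braiding $\beta$ is non-degenerate, i.e. whose only transparent simple object is the unit $\mathbf{1}$), let $\overline{\mathcal{C}}$ be $\mathcal{C}$ with the reversed braiding, and let $\mathfrak{Z}(\mathcal{C})$ be the Drinfeld center. Let $B$ be a 1d condensable algebra in $\mathcal{C}$, i.e. an indecomposable separable algebra. Conventions. If $\mathcal{D}$ is a braided monoidal category, $\mathcal{M}$ a monoidal category and $F:\mathcal{D}\to\mathfrak{Z}(\mathcal{M})$ a braided monoidal functor, put $A\odot N:=F(A)\otimes N$. For algebras $A$ in $\mathcal{D}$ and $N$ in $\mathcal{M}$, $A\odot N$ is an algebra in $\mathcal{M}$, with multiplication formed by moving $N$ past $F(A)$ along the inverse half-braiding of $F(A)$. A unital $A$-action on $N$ is an algebra homomorphism $A\odot N\to N$ whose composition with $N\cong\mathbf{1}\odot N\to A\odot N$ is $\mathrm{id}_N$. The left center of $N$ in $\mathcal{D}$ is a terminal object among the pairs consisting of an algebra in $\mathcal{D}$ and a unital action of it on $N$ (morphisms being the algebra homomorphisms compatible with the actions). For $\mathcal{M}=\mathcal{C}$,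 the left center $Z_l(B)$ is the left center of $B$ in $\mathcal{D}=\mathcal{C}$ for $F(X)=(X,\beta_{X,-})=:X\boxtimes\mathbf{1}$; the right center $Z_r(B)$ is the left center of $B$ in $\mathcal{D}=\overline{\mathcal{C}}$ for $F(Y)=(Y,\beta_{-,Y}^{-1})=:\mathbf{1}\boxtimes Y$; the full center $Z(B)$ is the left center of $B$ in $\mathcal{D}=\mathfrak{Z}(\mathcal{C})$ for $F=\mathrm{id}$. Identify $\mathcal{C}\boxtimes\overline{\mathcal{C}}$ with $\mathfrak{Z}(\mathcal{C})$ through the canonical functor $X\boxtimes Y\mapsto (X\boxtimes\mathbf{1})\otimes(\mathbf{1}\boxtimes Y)$, so that $\mathcal{C}\boxtimes\mathbf{1}$ and $\mathbf{1}\boxtimes\overline{\mathcal{C}}$ are full subcategories of $\mathfrak{Z}(\mathcal{C})$ (closed under isomorphism). For such a subcategory $\mathcal{P}$, $Z(B)\cap\mathcal{P}$ denotes the largest subobject of $Z(B)$ that lies in $\mathcal{P}$, with the algebra structure induced from $Z(B)$. Statement. Let $Z(B)$ be the full center of $B$. Then the intersections $Z(B)\cap(\mathcal{C}\boxtimes\mathbf{1})$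 and $Z(B)\cap(\mathbf{1}\boxtimes\overline{\mathcal{C}})$ and the left and right centers $Z_l(B)$ and $Z_r(B)$ exist, and there are isomorphisms of algebras in $\mathfrak{Z}(\mathcal{C})$ $$Z_l(B)\boxtimes\mathbf{1}\;\cong\; Z(B)\cap(\mathcal{C}\boxtimes\mathbf{1}),\qquad \mathbf{1}\boxtimes Z_r(B)\;\cong\; Z(B)\cap(\mathbf{1}\boxtimes\overline{\mathcal{C}}).$$ -/

import Mathlib

open CategoryTheory MonoidalCategory Limits MonObj

universe v v₁ u u₁

/-! ### Modular tensor categories -/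

attribute [local instance] Abelian.hasFiniteBiproducts

/-- A modular tensor category over `ℂ`: a braided fusion category with a ribbon structure whose
only transparent simple object is the unit. The underlying `ℂ`-linear abelian rigid braided
monoidal category (with bilinear tensor product) is given by the instance arguments. -/
class ModularTensorCategory (C : Type u) [Category.{v} C] [Abelian C] [Linear ℂ C]
    [MonoidalCategory C] [MonoidalPreadditive C] [MonoidalLinear ℂ C] [RigidCategory C]
    [BraidedCategory C] where
  finiteDimensional_hom : ∀ X Y : C, FiniteDimensional ℂ (X ⟶ Y)
  simple_unit : Simple (𝟙_ C)
  semisimple : ∀ X : C, ∃ (n : ℕ) (S : Fin n → C), (∀ i, Simple (S i)) ∧ Nonempty (X ≅ ⨁ S)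
  finite_simples : ∃ (n : ℕ) (S : Fin n → C), ∀ X : C, Simple X → ∃ i, Nonempty (X ≅ S i)
  /-- the ribbon twist -/
  twist : 𝟭 C ≅ 𝟭 C
  twist_tensor : ∀ X Y : C, twist.hom.app (X ⊗ Y) =
    (twist.hom.app X ⊗ₘ twist.hom.app Y) ≫ (β_ X Y).hom ≫ (β_ Y X).hom
  twist_dual : ∀ X : C, twist.hom.app (Xᘁ) = (twist.hom.app X)ᘁ
  nondegenerate : ∀ X : C, Simple X →
    (∀ Y : C, (β_ X Y).hom ≫ (β_ Y X).hom = 𝟙 (X ⊗ Y)) → Nonempty (X ≅ 𝟙_ C)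

/-! ### 1d condensable algebras -/

section Condensable

variable {C : Type u} [Category.{v} C] [MonoidalCategory C]

/-- The multiplication splits as a homomorphism of bimodules. -/
def IsSeparableAlg (B : Mon C) : Prop :=
  ∃ s : B.X ⟶ B.X ⊗ B.X, s ≫ μ[B.X] = 𝟙 B.X ∧
    B.X ◁ s ≫ (α_ B.X B.X B.X).inv ≫ μ[B.X] ▷ B.X = μ[B.X] ≫ s ∧
    s ▷ B.X ≫ (α_ B.X B.X B.X).hom ≫ B.X ◁ μ[B.X] = μ[B.X] ≫ s

/-- `B` is nonzero and is not the direct sum of two nonzero algebras. -/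
def IsIndecomposableAlg [Preadditive C] [HasBinaryBiproducts C] (B : Mon C) : Prop :=
  ¬ IsZero B.X ∧ ∀ (A₁ A₂ : Mon C) (p₁ : B ⟶ A₁) (p₂ : B ⟶ A₂),
    IsIso (biprod.lift p₁.hom p₂.hom) → IsZero A₁.X ∨ IsZero A₂.X

/-- A 1d (or `E₁`) condensable algebra is an indecomposable separable algebra. -/
def IsCondensableAlg [Preadditive C] [HasBinaryBiproducts C] (B : Mon C) : Prop :=
  IsSeparableAlg B ∧ IsIndecomposableAlg B

end Condensable

/-! ### The action of a braided category on a monoidal category -/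

section Action

variable {M : Type u} [Category.{v} M] [MonoidalCategory M]

/-- The algebra structure on `z ⊗ n` obtained by moving `n` past `z` along `s`. -/
@[reducible]
def twistedMonObj (z n : M) [MonObj z] [MonObj n] (s : n ⊗ z ⟶ z ⊗ n)
    (mul_left : μ[n] ▷ z ≫ s = (α_ n n z).hom ≫ n ◁ s ≫ (α_ n z n).inv ≫ s ▷ n ≫
      (α_ z n n).hom ≫ z ◁ μ[n])
    (one_left : η[n] ▷ z ≫ s = (λ_ z).hom ≫ (ρ_ z).inv ≫ z ◁ η[n])
    (mul_right : n ◁ μ[z] ≫ s = (α_ n z z).inv ≫ s ▷ z ≫ (α_ z n z).hom ≫ z ◁ s ≫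
      (α_ z z n).inv ≫ μ[z] ▷ n)
    (one_right : n ◁ η[z] ≫ s = (ρ_ n).hom ≫ (λ_ n).inv ≫ η[z] ▷ n) :
    MonObj (z ⊗ n) where
  one := (λ_ (𝟙_ M)).inv ≫ (η[z] ⊗ₘ η[n])
  mul := (α_ z n (z ⊗ n)).hom ≫ z ◁ ((α_ n z n).inv ≫ s ▷ n ≫ (α_ z n n).hom) ≫
    (α_ z z (n ⊗ n)).inv ≫ (μ[z] ⊗ₘ μ[n])
  one_mul := by
    calc
      _ = 𝟙 _ ⊗≫ η[z] ▷ (z ⊗ n) ⊗≫ z ◁ (η[n] ▷ z ≫ s) ▷ n ⊗≫ μ[z] ▷ (n ⊗ n) ⊗≫ z ◁ μ[n] := by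
        simp only [MonoidalCategory.tensorHom_def]
        monoidal
      _ = 𝟙 _ ⊗≫ (η[z] ▷ z ≫ μ[z]) ▷ n ⊗≫ z ◁ (η[n] ▷ n ≫ μ[n]) := by
        rw [one_left]
        calc
          _ = 𝟙 _ ⊗≫ η[z] ▷ (z ⊗ n) ⊗≫ (((z ⊗ z) ◁ η[n] ≫ μ[z] ▷ n) ▷ n) ⊗≫ z ◁ μ[n] := by
            monoidal
          _ = _ := by
            rw [whisker_exchange]; monoidal
      _ = _ := by
        rw [MonObj.one_mul, MonObj.one_mul]; monoidal
  mul_one := by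
    calc
      _ = 𝟙 _ ⊗≫ (z ⊗ n) ◁ (η[z] ▷ 𝟙_ M ≫ z ◁ η[n]) ⊗≫ z ◁ s ▷ n ⊗≫ (μ[z] ▷ (n ⊗ n) ≫ z ◁ μ[n]) := by
        simp only [MonoidalCategory.tensorHom_def]
        monoidal
      _ = 𝟙 _ ⊗≫ (z ⊗ n) ◁ η[n] ⊗≫ z ◁ (n ◁ η[z] ≫ s) ▷ n ⊗≫ (μ[z] ▷ (n ⊗ n) ≫ z ◁ μ[n]) := by
        rw [← whisker_exchange]; monoidal
      _ = 𝟙 _ ⊗≫ (z ◁ η[z] ≫ μ[z]) ▷ n ⊗≫ z ◁ (n ◁ η[n] ≫ μ[n]) := by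
        rw [one_right]
        calc
          _ = 𝟙 _ ⊗≫ z ◁ (𝟙_ M ◁ (n ◁ η[n]) ≫ η[z] ▷ (n ⊗ n)) ⊗≫ (μ[z] ▷ (n ⊗ n) ≫ z ◁ μ[n]) := by
            monoidal
          _ = 𝟙 _ ⊗≫ z ◁ (η[z] ▷ (n ⊗ 𝟙_ M)) ⊗≫ ((z ⊗ z) ◁ (n ◁ η[n]) ≫ μ[z] ▷ (n ⊗ n)) ⊗≫ z ◁ μ[n] := by
            rw [whisker_exchange]; monoidal
          _ = _ := by
            rw [whisker_exchange]; monoidal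
      _ = _ := by
        rw [MonObj.mul_one, MonObj.mul_one]; monoidal
  mul_assoc := by
    calc
      _ = 𝟙 _ ⊗≫ z ◁ s ▷ (n ⊗ z ⊗ n) ⊗≫ μ[z] ▷ (n ⊗ n ⊗ z ⊗ n) ⊗≫
            z ◁ (μ[n] ▷ z ≫ s) ▷ n ⊗≫ μ[z] ▷ (n ⊗ n) ⊗≫ z ◁ μ[n] := by
        simp only [MonoidalCategory.tensorHom_def]
        monoidal
      _ = 𝟙 _ ⊗≫ z ◁ s ▷ (n ⊗ z ⊗ n) ⊗≫ μ[z] ▷ (n ⊗ n ⊗ z ⊗ n) ⊗≫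
            z ◁ (n ◁ s ⊗≫ s ▷ n) ▷ n ⊗≫ (((z ⊗ z) ◁ μ[n] ≫ μ[z] ▷ n) ▷ n) ⊗≫ z ◁ μ[n] := by
        rw [mul_left]; monoidal
      _ = 𝟙 _ ⊗≫ z ◁ s ▷ (n ⊗ z ⊗ n) ⊗≫ (μ[z] ▷ (n ⊗ n ⊗ z ⊗ n) ≫
            z ◁ (𝟙 (n ⊗ n ⊗ z ⊗ n) ⊗≫ n ◁ s ▷ n ⊗≫ s ▷ (n ⊗ n) ⊗≫ 𝟙 (z ⊗ n ⊗ n ⊗ n))) ⊗≫ μ[z] ▷ (n ⊗ n ⊗ n) ⊗≫ z ◁ (μ[n] ▷ n ≫ μ[n]) := by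
        rw [whisker_exchange]; monoidal
      _ = 𝟙 _ ⊗≫ z ◁ s ▷ (n ⊗ z ⊗ n) ⊗≫
            (z ⊗ z) ◁ (𝟙 (n ⊗ n ⊗ z ⊗ n) ⊗≫ n ◁ s ▷ n ⊗≫ s ▷ (n ⊗ n)) ⊗≫ (μ[z] ▷ z ≫ μ[z]) ▷ (n ⊗ n ⊗ n) ⊗≫ z ◁ (μ[n] ▷ n ≫ μ[n]) := by
        rw [← whisker_exchange]; monoidal
      _ = 𝟙 _ ⊗≫ z ◁ (s ▷ (n ⊗ z) ≫ (z ⊗ n) ◁ s) ▷ n ⊗≫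
            (z ⊗ z) ◁ (s ▷ (n ⊗ n)) ⊗≫ (z ◁ μ[z] ≫ μ[z]) ▷ (n ⊗ n ⊗ n) ⊗≫ z ◁ (n ◁ μ[n] ≫ μ[n]) := by
        rw [MonObj.mul_assoc, MonObj.mul_assoc]; monoidal
      _ = 𝟙 _ ⊗≫ z ◁ n ◁ z ◁ s ▷ n ⊗≫ z ◁ (s ▷ z ⊗≫ z ◁ s ⊗≫ μ[z] ▷ n) ▷ (n ⊗ n) ⊗≫
           (μ[z] ▷ (n ⊗ (n ⊗ n)) ≫ z ◁ (n ◁ μ[n])) ⊗≫ z ◁ μ[n] := by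
        rw [← whisker_exchange]; monoidal
      _ = 𝟙 _ ⊗≫ z ◁ n ◁ z ◁ s ▷ n ⊗≫ z ◁ ((n ◁ μ[z] ≫ s) ▷ (n ⊗ n) ≫ (z ⊗ n) ◁ μ[n]) ⊗≫
           μ[z] ▷ (n ⊗ n) ⊗≫ z ◁ μ[n] := by
        rw [mul_right, ← whisker_exchange]; monoidal
      _ = 𝟙 _ ⊗≫ z ◁ n ◁ z ◁ s ▷ n ⊗≫ z ◁ (n ◁ (μ[z] ▷ (n ⊗ n) ≫ z ◁ μ[n])) ⊗≫ z ◁ s ▷ n ⊗≫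
           μ[z] ▷ (n ⊗ n) ⊗≫ z ◁ μ[n] := by
        have : (n ◁ μ[z] ≫ s) ▷ (n ⊗ n) ≫ (z ⊗ n) ◁ μ[n] =
            𝟙 _ ⊗≫ n ◁ (μ[z] ▷ (n ⊗ n) ≫ z ◁ μ[n]) ⊗≫ s ▷ n := by
          rw [comp_whiskerRight, Category.assoc, ← whisker_exchange]; monoidal
        rw [this]; monoidal
      _ = _ := by
        simp only [MonoidalCategory.tensorHom_def]
        monoidal

/-- Moving an object `N` past an object `Z` of the Drinfeld center, from left to right, along the
inverse of the half-braiding `Z ⊗ N ≅ N ⊗ Z`. -/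
def centerPass (Z : Center M) (N : M) :
    N ⊗ (Center.forget M).obj Z ⟶ (Center.forget M).obj Z ⊗ N :=
  (Z.2.β N).inv

lemma centerPass_naturality (Z : Center M) {N N' : M} (f : N ⟶ N') :
    f ▷ (Center.forget M).obj Z ≫ centerPass Z N' =
      centerPass Z N ≫ (Center.forget M).obj Z ◁ f :=
  (CommSq.mk (Z.2.naturality f)).vert_inv.w

lemma centerPass_hom {Z W : Center M} (f : Z ⟶ W) (N : M) :
    N ◁ (Center.forget M).map f ≫ centerPass W N =
      centerPass Z N ≫ (Center.forget M).map f ▷ N :=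
  (CommSq.mk (f.comm N)).vert_inv.w

lemma halfBraiding_inv_tensor {z : M} (h : HalfBraiding z) (N N' : M) :
    (h.β (N ⊗ N')).inv = (α_ N N' z).hom ≫ N ◁ (h.β N').inv ≫ (α_ N z N').inv ≫
      (h.β N).inv ▷ N' ≫ (α_ z N N').hom := by
  rw [← cancel_epi (h.β (N ⊗ N')).hom, Iso.hom_inv_id, h.monoidal]
  simp

lemma halfBraiding_inv_unit {z : M} (h : HalfBraiding z) :
    (h.β (𝟙_ M)).inv = (λ_ z).hom ≫ (ρ_ z).inv := by
  have h1 := (CommSq.mk (h.naturality (λ_ (𝟙_ M)).hom)).vert_inv.w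
  rw [halfBraiding_inv_tensor h] at h1
  have h3 : (λ_ z).inv ≫ (h.β (𝟙_ M)).inv ≫ (ρ_ z).hom =
      ((λ_ z).inv ≫ (h.β (𝟙_ M)).inv ≫ (ρ_ z).hom) ≫
        (λ_ z).inv ≫ (h.β (𝟙_ M)).inv ≫ (ρ_ z).hom := by
    calc
      _ = 𝟙 _ ⊗≫ ((λ_ (𝟙_ M)).hom ▷ z ≫ (h.β (𝟙_ M)).inv) ⊗≫ 𝟙 _ := by monoidal
      _ = 𝟙 _ ⊗≫ 𝟙_ M ◁ (h.β (𝟙_ M)).inv ⊗≫ (h.β (𝟙_ M)).inv ▷ 𝟙_ M ⊗≫ 𝟙 z := by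
        rw [h1]; monoidal
      _ = _ := by monoidal
  have h4 : (λ_ z).inv ≫ (h.β (𝟙_ M)).inv ≫ (ρ_ z).hom = 𝟙 z := by
    rw [← cancel_epi ((λ_ z).inv ≫ (h.β (𝟙_ M)).inv ≫ (ρ_ z).hom), ← h3, Category.comp_id]
  rw [Iso.inv_comp_eq, ← Iso.eq_comp_inv] at h4
  simpa using h4

lemma centerPass_tensor (Z : Center M) (N N' : M) :
    centerPass Z (N ⊗ N') = (α_ N N' _).hom ≫ N ◁ centerPass Z N' ≫ (α_ N _ N').inv ≫
      centerPass Z N ▷ N' ≫ (α_ _ N N').hom :=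
  halfBraiding_inv_tensor Z.2 N N'

lemma centerPass_unit (Z : Center M) :
    centerPass Z (𝟙_ M) = (λ_ _).hom ≫ (ρ_ _).inv :=
  halfBraiding_inv_unit Z.2

lemma tensor_centerPass (Z W : Center M) (N : M) :
    centerPass (Z ⊗ W) N = (α_ N ((Center.forget M).obj Z) ((Center.forget M).obj W)).inv ≫
      centerPass Z N ▷ _ ≫ (α_ _ N _).hom ≫ _ ◁ centerPass W N ≫ (α_ _ _ N).inv := by
  refine Eq.trans (b := (α_ N Z.1 W.1).inv ≫ (Z.2.β N).inv ▷ W.1 ≫ (α_ Z.1 N W.1).hom ≫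
    Z.1 ◁ (W.2.β N).inv ≫ (α_ Z.1 W.1 N).inv) ?_ rfl
  change (_ ≪≫ _).inv = _
  simp

lemma unit_centerPass (N : M) :
    centerPass (𝟙_ (Center M)) N = (ρ_ N).hom ≫ (λ_ N).inv :=
  rfl

/-- The algebra structure on `Z ⊗ N`, for an algebra `Z` in the Drinfeld center of `M` and an
algebra `N` in `M`. -/
noncomputable abbrev centerTensorMonObj (Z : Center M) [MonObj Z] (N : M) [MonObj N] :
    MonObj ((Center.forget M).obj Z ⊗ N) :=
  letI : MonObj ((Center.forget M).obj Z) := (Center.forget M).monObjObj Z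
  twistedMonObj ((Center.forget M).obj Z) N (centerPass Z N)
    (by rw [centerPass_naturality, centerPass_tensor]; simp)
    (by rw [centerPass_naturality, centerPass_unit]; simp)
    (by
      have e : ((Center.forget M).monObjObj Z).mul = (Center.forget M).map μ[Z] :=
        Category.id_comp _
      have h := centerPass_hom μ[Z] N
      rw [tensor_centerPass] at h
      rw [show μ[(Center.forget M).obj Z] = _ from e]
      refine h.trans ?_
      iterate 4 refine (Category.assoc _ _ _).trans (congrArg _ ?_)
      rfl)
    (by
      have e : ((Center.forget M).monObjObj Z).one = (Center.forget M).map η[Z] :=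
        Category.id_comp _
      have h := centerPass_hom η[Z] N
      rw [unit_centerPass] at h
      rw [show η[(Center.forget M).obj Z] = _ from e]
      refine h.trans ?_
      exact Category.assoc _ _ _)

variable {D : Type u₁} [Category.{v₁} D] [MonoidalCategory D] [BraidedCategory D]

/-- The object `A ⊙ N` of `M`, for the monoidal left `D`-module structure on `M` given by a braided
monoidal functor `F` from `D` to the Drinfeld center of `M`. -/
abbrev actObj (F : D ⥤ Center M) (A : D) (N : M) : M :=
  (Center.forget M).obj (F.obj A) ⊗ N

/-- The morphism `f ⊙ N`. -/
abbrev actMap (F : D ⥤ Center M) {A A' : D} (f : A ⟶ A') (N : M) : actObj F A N ⟶ actObj F A' N :=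
  (Center.forget M).map (F.map f) ▷ N

/-- The unit isomorphism `N ≅ 𝟙 ⊙ N`. -/
noncomputable def actUnitIso (F : D ⥤ Center M) [F.Braided] (N : M) : N ≅ actObj F (𝟙_ D) N :=
  (λ_ N).symm ≪≫ whiskerRightIso (Functor.Monoidal.εIso (F ⋙ Center.forget M)) N

/-- The algebra `A ⊙ N` in `M`, for algebras `A` in `D` and `N` in `M`. -/
noncomputable def actAlg (F : D ⥤ Center M) [F.Braided] (A : Mon D) (N : Mon M) : Mon M where
  X := actObj F A.X N.X
  mon :=
    letI : MonObj (F.obj A.X) := F.monObjObj A.X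
    centerTensorMonObj (F.obj A.X) N.X

/-- A unital `A`-action on the algebra `N`: an algebra homomorphism `A ⊙ N ⟶ N` whose composition
with `N ≅ 𝟙 ⊙ N ⟶ A ⊙ N` is the identity. -/
structure UnitalAction (F : D ⥤ Center M) [F.Braided] (A : Mon D) (N : Mon M) where
  /-- the algebra homomorphism `A ⊙ N ⟶ N` -/
  act : actAlg F A N ⟶ N
  unital : (actUnitIso F N.X).hom ≫ actMap F η[A.X] N.X ≫ act.hom = 𝟙 N.X

/-- The pair `(Z, u)` is a left center of `N` in `D`: it is terminal among the algebras in `D` with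
a unital action on `N`. -/
def IsLeftCenter (F : D ⥤ Center M) [F.Braided] (N : Mon M) (Z : Mon D)
    (u : UnitalAction F Z N) : Prop :=
  ∀ (X : Mon D) (t : UnitalAction F X N),
    ∃! f : X ⟶ Z, actMap F f.hom N.X ≫ u.act.hom = t.act.hom

/-- The pair `(Z, u)` is a full center of `N`: a left center of `N` in the Drinfeld center of `M`,
which acts on `M` through the identity functor. -/
def IsFullCenter (N : Mon M) (Z : Mon (Center M)) (u : UnitalAction (𝟭 (Center M)) Z N) : Prop :=
  IsLeftCenter (𝟭 (Center M)) N Z u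

end Action

/-! ### The two embeddings of a braided category into its Drinfeld center -/

section Embeddings

/-- The monoidal category `C`, to be equipped with the reversed braiding. -/
def RevBraided (C : Type u) : Type u := C

variable (C : Type u) [Category.{v} C] [MonoidalCategory C]

instance : Category.{v} (RevBraided C) := inferInstanceAs (Category.{v} C)

instance : MonoidalCategory (RevBraided C) := inferInstanceAs (MonoidalCategory C)

variable [BraidedCategory C]

instance : BraidedCategory (RevBraided C) := reverseBraiding C

/-- The canonical braided functor `X ↦ (X, β_{X,-})` from `C` to its Drinfeld center. It makes `C` a
monoidal left `C`-module with action given by the tensor product. -/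
noncomputable abbrev leftEmbedding : C ⥤ Center C := Center.ofBraided C

noncomputable instance : (leftEmbedding C).Braided where
  braided X Y := by
    apply Center.ext
    exact (Category.id_comp _).trans (Category.comp_id _).symm

/-- The canonical braided functor `Y ↦ (Y, β_{-,Y}⁻¹)` from `C` with the reversed braiding to the
Drinfeld center of `C`. It makes `C` a monoidal right `C`-module. -/
noncomputable def rightEmbedding : RevBraided C ⥤ Center C :=
  Center.ofBraided (RevBraided C)

noncomputable instance : (rightEmbedding C).Braided :=
  inferInstanceAs (leftEmbedding (RevBraided C)).Braided


variable {C}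

/-- The object `X ⊠ Y` of the Drinfeld center of `C`, that is, the image of the object `X ⊠ Y` of
the Deligne product of `C` and its reverse under the canonical functor to the center. -/
noncomputable def boxProd (X : C) (Y : RevBraided C) : Center C :=
  (leftEmbedding C).obj X ⊗ (rightEmbedding C).obj Y

variable (C)

/-- The full subcategory `C ⊠ 𝟙` of the Drinfeld center. -/
def leftFactor : ObjectProperty (Center C) :=
  fun W => ∃ X : C, Nonempty (W ≅ boxProd X (𝟙_ (RevBraided C)))

/-- The full subcategory `𝟙 ⊠ C̄` of the Drinfeld center. -/
def rightFactor : ObjectProperty (Center C) :=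
  fun W => ∃ Y : RevBraided C, Nonempty (W ≅ boxProd (𝟙_ C) Y)

end Embeddings

/-- The algebra `I`, with the homomorphism `j` to the algebra `Z`, is the intersection of `Z` with
the full subcategory `P`: the largest subobject of `Z` that belongs to `P`, with the algebra
structure induced from `Z`. -/
structure IsIntersection {E : Type u} [Category.{v} E] [MonoidalCategory E]
    (P : ObjectProperty E) {I Z : Mon E} (j : I ⟶ Z) : Prop where
  mono : Mono j.hom
  mem : P I.X
  largest : ∀ (S : E) (s : S ⟶ Z.X), Mono s → P S → ∃ g : S ⟶ I.X, g ≫ j.hom = s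

/-!
A half-braided object `Z` has a largest subobject on which the half-braiding is the braiding of `C`.
For a fixed `U`, agreement with the braiding of `U` cuts out an equalizer, because `U ⊗ -` is a left
adjoint, and since the objects of `C` are Artinian, finitely many `U` already impose all the
conditions. These subobjects form a right adjoint `G`, with monic counit, of the embedding `F` of
`C` into its Drinfeld center, and likewise for the reversed braiding.

A right adjoint of a strong monoidal functor is lax monoidal, so `F ⊣ G` lifts to algebras. An
action of `A` through `F` is the same as an action of the algebra `F A` of the center, that is, an
algebra homomorphism from `F A` to `Z(B)`, or from `A` to `G Z(B)`: the left center is `G Z(B)`.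
Since the counit is monic, `F G Z(B)` is a subobject of `Z(B)`, and by the universal property of the
counit it is the intersection of `Z(B)` with the essential image of `F`.
-/

/-! ### Right adjoints of the embeddings -/

section ArtinianObjects

variable {C : Type u} [Category.{v} C]

lemma exists_finset_inf_le {α J : Type*} [SemilatticeInf α] [OrderTop α] [WellFoundedLT α]
    (f : J → α) : ∃ s : Finset J, ∀ i, s.inf f ≤ f i := by
  classical
  obtain ⟨_, ⟨s, rfl⟩, hs⟩ := wellFounded_lt.has_min (Set.range fun s : Finset J => s.inf f)
    (Set.range_nonempty _)
  refine ⟨s, fun i => ?_⟩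
  have hle : (insert i s).inf f ≤ s.inf f := Finset.inf_mono (Finset.subset_insert i s)
  rw [← hle.eq_of_not_lt (hs _ ⟨_, rfl⟩)]
  exact Finset.inf_le (Finset.mem_insert_self i s)

lemma exists_subobject_factors_iff_forall [HasPullbacks C] {X : C} [IsArtinianObject X]
    {J : Type*} (E : J → Subobject X) :
    ∃ S : Subobject X, ∀ {Y : C} (f : Y ⟶ X), S.Factors f ↔ ∀ i, (E i).Factors f := by
  obtain ⟨s, hs⟩ := exists_finset_inf_le E
  refine ⟨s.inf E, fun f => ⟨fun hf i => Subobject.factors_of_le f (hs i) hf, fun hf => ?_⟩⟩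
  exact (Subobject.finset_inf_factors f).2 fun i _ => hf i

theorem isArtinianObject_of_isSeparator [Preadditive C] [Balanced C] (R : Type*) [Semiring R]
    [Linear R C] {G : C} (hG : IsSeparator G) (X : C) [IsArtinian R (G ⟶ X)] :
    IsArtinianObject X := by
  let homs (U : Subobject X) : Submodule R (G ⟶ X) :=
    LinearMap.range (Linear.rightComp R G U.arrow)
  have mem_homs_iff (U : Subobject X) (f : G ⟶ X) : f ∈ homs U ↔ U.Factors f :=
    ⟨fun ⟨g, hg⟩ => hg ▸ Subobject.factors_comp_arrow g,
      fun hf => ⟨U.factorThru f hf, U.factorThru_arrow f hf⟩⟩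
  have homs_strictMono : StrictMono homs := fun U V hUV => by
    refine lt_of_le_of_ne (fun f hf => ?_) fun h => hUV.ne ?_
    · exact (mem_homs_iff V f).2 (Subobject.factors_of_le f hUV.le ((mem_homs_iff U f).1 hf))
    · refine Subobject.eq_of_le_of_isDetecting hG.isDetector U V hUV.le ?_
      rintro _ ⟨⟩ f hf
      rwa [← mem_homs_iff, h, mem_homs_iff]
  exact ⟨homs_strictMono.wellFoundedLT⟩

lemma isSeparator_biproduct_of_forall_iso [HasZeroMorphisms C] [HasFiniteBiproducts C]
    {J : Type*} (S : J → C) [HasBiproduct S]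
    (hS : ∀ X : C, ∃ (m : ℕ) (T : Fin m → C),
      (∀ k, ∃ l, Nonempty (T k ≅ S l)) ∧ Nonempty (X ≅ ⨁ T)) :
    IsSeparator (⨁ S) := by
  refine isSeparator_of_isColimit_cofan (f := S) (fun X Y f g hfg => ?_) (biproduct.isColimit S)
  obtain ⟨m, T, hT, ⟨e⟩⟩ := hS X
  rw [← cancel_epi e.inv]
  refine biproduct.hom_ext' _ _ fun k => ?_
  obtain ⟨l, ⟨a⟩⟩ := hT k
  rw [← cancel_epi a.inv]
  simpa only [Category.assoc] using hfg _ (.mk l) (a.inv ≫ biproduct.ι T k ≫ e.inv)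

theorem ModularTensorCategory.isArtinianObject [Abelian C] [Linear ℂ C] [MonoidalCategory C]
    [MonoidalPreadditive C] [MonoidalLinear ℂ C] [RigidCategory C] [BraidedCategory C]
    [ModularTensorCategory C] (X : C) : IsArtinianObject X := by
  obtain ⟨n, S, hS⟩ := ModularTensorCategory.finite_simples (C := C)
  have isSeparator_simples : IsSeparator (⨁ S) :=
    isSeparator_biproduct_of_forall_iso S fun Y => by
      obtain ⟨m, T, hT, e⟩ := ModularTensorCategory.semisimple Y
      exact ⟨m, T, fun k => hS _ (hT k), e⟩
  have := ModularTensorCategory.finiteDimensional_hom (⨁ S) X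
  exact isArtinianObject_of_isSeparator ℂ isSeparator_simples X

end ArtinianObjects

section BraidingSubobject

variable {C : Type u} [Category.{v} C] [MonoidalCategory C] [MonoidalClosed C] [HasEqualizers C]

lemma factors_equalizerSubobject_curry_iff {U V X Y : C} (d d' : U ⊗ X ⟶ V) (f : Y ⟶ X) :
    (equalizerSubobject (MonoidalClosed.curry d) (MonoidalClosed.curry d')).Factors f ↔
      U ◁ f ≫ d = U ◁ f ≫ d' := by
  rw [equalizerSubobject_factors_iff, ← MonoidalClosed.curry_natural_left,
    ← MonoidalClosed.curry_natural_left, MonoidalClosed.curry_injective.eq_iff]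

variable [BraidedCategory C] [HasPullbacks C]

lemma exists_braidingSubobject (Z : Center C) [IsArtinianObject Z.1] :
    ∃ S : Subobject Z.1, ∀ {Y : C} (f : Y ⟶ Z.1), S.Factors f ↔
      ∀ U, f ▷ U ≫ (Z.2.β U).hom = (β_ Y U).hom ≫ U ◁ f := by
  obtain ⟨S, hS⟩ := exists_subobject_factors_iff_forall fun U : C =>
    equalizerSubobject (MonoidalClosed.curry (Z.2.β U).inv)
      (MonoidalClosed.curry (β_ Z.1 U).inv)
  refine ⟨S, fun f => (hS f).trans (forall_congr' fun U => ?_)⟩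
  rw [factors_equalizerSubobject_curry_iff, BraidedCategory.braiding_inv_naturality_right,
    Iso.eq_inv_comp, ← Category.assoc, Iso.comp_inv_eq, eq_comm]

/-- The largest subobject of the object underlying `Z` on which the half-braiding of `Z` coincides
with the braiding of `C`. -/
noncomputable def braidingSubobject (Z : Center C) [IsArtinianObject Z.1] : Subobject Z.1 :=
  (exists_braidingSubobject Z).choose

lemma braidingSubobject_factors_iff (Z : Center C) [IsArtinianObject Z.1] {Y : C} (f : Y ⟶ Z.1) :
    (braidingSubobject Z).Factors f ↔ ∀ U, f ▷ U ≫ (Z.2.β U).hom = (β_ Y U).hom ≫ U ◁ f :=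
  (exists_braidingSubobject Z).choose_spec f

/-- The inclusion of `braidingSubobject Z` into `Z`, as a morphism of the Drinfeld center. -/
noncomputable def braidingSubobjectArrow (Z : Center C) [IsArtinianObject Z.1] :
    (leftEmbedding C).obj (braidingSubobject Z : C) ⟶ Z where
  f := (braidingSubobject Z).arrow
  comm := (braidingSubobject_factors_iff Z _).1 (Subobject.factors_self _)

lemma mono_braidingSubobjectArrow (Z : Center C) [IsArtinianObject Z.1] :
    Mono (braidingSubobjectArrow Z) where
  right_cancellation _ _ h :=
    Center.ext _ _ ((cancel_mono (braidingSubobject Z).arrow).1 (congrArg Center.Hom.f h))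

/-- The universal property of `braidingSubobject Z`: morphisms into it are the morphisms into `Z`
from objects in the image of the left embedding. -/
@[simps]
noncomputable def braidingSubobjectHomEquiv (Y : C) (Z : Center C) [IsArtinianObject Z.1] :
    ((leftEmbedding C).obj Y ⟶ Z) ≃ (Y ⟶ (braidingSubobject Z : C)) where
  toFun f := (braidingSubobject Z).factorThru f.f
    ((braidingSubobject_factors_iff Z f.f).2 f.comm)
  invFun g := (leftEmbedding C).map g ≫ braidingSubobjectArrow Z
  left_inv f := Center.ext _ _ ((braidingSubobject Z).factorThru_arrow f.f
    ((braidingSubobject_factors_iff Z f.f).2 f.comm))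
  right_inv g := by
    rw [← cancel_mono (braidingSubobject Z).arrow]
    exact Subobject.factorThru_arrow _ _ _

theorem exists_leftEmbedding_adjunction [∀ X : C, IsArtinianObject X] :
    ∃ (G : Center C ⥤ C) (adj : leftEmbedding C ⊣ G), ∀ Z, Mono (adj.counit.app Z) := by
  let e (Y : C) (Z : Center C) := braidingSubobjectHomEquiv Y Z
  have naturality (Y' Y : C) (Z : Center C) (f : Y' ⟶ Y) (g : (leftEmbedding C).obj Y ⟶ Z) :
      e Y' Z ((leftEmbedding C).map f ≫ g) = f ≫ e Y Z g :=
    (Subobject.factorThru_right f g.f ((braidingSubobject_factors_iff Z _).2 g.comm)).symm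
  refine ⟨_, Adjunction.adjunctionOfEquivRight e naturality, fun Z => ?_⟩
  have counit_app : (Adjunction.adjunctionOfEquivRight e naturality).counit.app Z =
      braidingSubobjectArrow Z := by
    simp [e]
  rw [counit_app]
  exact mono_braidingSubobjectArrow Z

theorem exists_rightEmbedding_adjunction [∀ X : C, IsArtinianObject X] :
    ∃ (G : Center C ⥤ RevBraided C) (adj : rightEmbedding C ⊣ G), ∀ Z, Mono (adj.counit.app Z) :=
  -- the right embedding of `C` is the left embedding for the reversed braiding
  @exists_leftEmbedding_adjunction C _ _ _ _ (reverseBraiding C) _ _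

end BraidingSubobject

/-! ### Actions and left centers -/

section Actions

variable {M : Type u} [Category.{v} M] [MonoidalCategory M]

/-- The multiplication of the algebra structure `twistedMonObj` on `z ⊗ n`. -/
def twistedMul (z n : M) [MonObj z] [MonObj n] (s : n ⊗ z ⟶ z ⊗ n) :
    (z ⊗ n) ⊗ (z ⊗ n) ⟶ z ⊗ n :=
  (α_ z n (z ⊗ n)).hom ≫ z ◁ ((α_ n z n).inv ≫ s ▷ n ≫ (α_ z n n).hom) ≫
    (α_ z z (n ⊗ n)).inv ≫ (μ[z] ⊗ₘ μ[n])

lemma twistedMul_comp_whiskerRight {z z' n : M} [MonObj z] [MonObj z'] [MonObj n]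
    {s : n ⊗ z ⟶ z ⊗ n} {s' : n ⊗ z' ⟶ z' ⊗ n} (f : z ⟶ z') [IsMonHom f]
    (hf : n ◁ f ≫ s' = s ≫ f ▷ n) :
    twistedMul z n s ≫ f ▷ n = (f ▷ n ⊗ₘ f ▷ n) ≫ twistedMul z' n s' := by
  symm
  calc
    _ = 𝟙 _ ⊗≫ f ▷ (n ⊗ z ⊗ n) ⊗≫ z' ◁ (n ◁ f ≫ s') ▷ n ⊗≫ μ[z'] ▷ (n ⊗ n) ⊗≫ z' ◁ μ[n] := by
      simp only [twistedMul, MonoidalCategory.tensorHom_def]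
      monoidal
    _ = 𝟙 _ ⊗≫ (f ▷ (n ⊗ z) ≫ z' ◁ s) ▷ n ⊗≫ z' ◁ f ▷ (n ⊗ n) ⊗≫ μ[z'] ▷ (n ⊗ n) ⊗≫
        z' ◁ μ[n] := by
      rw [hf]
      monoidal
    _ = 𝟙 _ ⊗≫ z ◁ s ▷ n ⊗≫ ((f ▷ z ≫ z' ◁ f) ≫ μ[z']) ▷ (n ⊗ n) ⊗≫ z' ◁ μ[n] := by
      rw [← whisker_exchange]
      monoidal
    _ = 𝟙 _ ⊗≫ z ◁ s ▷ n ⊗≫ μ[z] ▷ (n ⊗ n) ⊗≫ (f ▷ (n ⊗ n) ≫ z' ◁ μ[n]) := by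
      rw [← MonoidalCategory.tensorHom_def, ← IsMonHom.mul_hom]
      monoidal
    _ = _ := by
      rw [← whisker_exchange]
      simp only [twistedMul, MonoidalCategory.tensorHom_def]
      monoidal

variable {D : Type u₁} [Category.{v₁} D]

lemma actMap_id (F : D ⥤ Center M) (A : D) (N : M) : actMap F (𝟙 A) N = 𝟙 _ := by
  rw [actMap, CategoryTheory.Functor.map_id, CategoryTheory.Functor.map_id, id_whiskerRight]

lemma actMap_comp (F : D ⥤ Center M) {A A' A'' : D} (f : A ⟶ A') (g : A' ⟶ A'') (N : M) :
    actMap F (f ≫ g) N = actMap F f N ≫ actMap F g N := by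
  rw [actMap, Functor.map_comp, Functor.map_comp, comp_whiskerRight]

variable [MonoidalCategory D]

lemma id_monObjObj (X : D) [m : MonObj X] : (𝟭 D).monObjObj X = m := by
  apply MonObj.ext
  exact Category.id_comp _

variable [BraidedCategory D] (F : D ⥤ Center M) [F.Braided]

/-- The homomorphism `f ⊙ N` of algebras in `M`. -/
noncomputable def actAlgMap {A A' : Mon D} (f : A ⟶ A') (N : Mon M) :
    actAlg F A N ⟶ actAlg F A' N where
  hom := actMap F f.hom N.X
  isMonHom_hom := by
    let := F.monObjObj A.X
    let := F.monObjObj A'.X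
    let := (Center.forget M).monObjObj (F.obj A.X)
    let := (Center.forget M).monObjObj (F.obj A'.X)
    refine ⟨?_, twistedMul_comp_whiskerRight _ (centerPass_hom (F.map f.hom) N.X)⟩
    change (_ ≫ (_ ⊗ₘ _)) ≫ _ ▷ _ = _ ≫ (_ ⊗ₘ _)
    rw [Category.assoc, ← tensorHom_id, tensorHom_comp_tensorHom, IsMonHom.one_hom,
      Category.comp_id]

lemma isMonHom_actAlg_id_mapMon_iff (A : Mon D) (N : Mon M) (f : actObj F A.X N.X ⟶ N.X) :
    IsMonHom (M := (actAlg (𝟭 (Center M)) (F.mapMon.obj A) N).X) (N := N.X) f ↔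
      IsMonHom (M := (actAlg F A N).X) (N := N.X) f := by
  change @IsMonHom M _ _ (actObj F A.X N.X) N.X (@centerTensorMonObj M _ _ (F.obj A.X)
    ((𝟭 (Center M)).monObjObj (F.mapMon.obj A).X) N.X _) _ f ↔ _
  rw [id_monObjObj (F.mapMon.obj A).X]
  rfl

lemma actUnitIso_hom_comp_actMap {X : D} (f : 𝟙_ D ⟶ X) (N : M) :
    (actUnitIso F N).hom ≫ actMap F f N =
      (λ_ N).inv ≫ (Functor.LaxMonoidal.ε (Center.forget M) ≫
        (Center.forget M).map (Functor.LaxMonoidal.ε F ≫ F.map f)) ▷ N := by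
  simp only [actUnitIso, actMap, Iso.trans_hom, Iso.symm_hom, whiskerRightIso_hom,
    Functor.Monoidal.εIso_hom, Functor.LaxMonoidal.comp_ε, Functor.map_comp, comp_whiskerRight,
    Category.assoc]

lemma actUnitIso_hom_comp_actMap_id_one (A : Mon D) (N : M) :
    (actUnitIso (𝟭 (Center M)) N).hom ≫ actMap (𝟭 (Center M)) η[(F.mapMon.obj A).X] N =
      (actUnitIso F N).hom ≫ actMap F η[A.X] N := by
  rw [actUnitIso_hom_comp_actMap, actUnitIso_hom_comp_actMap, Functor.LaxMonoidal.id_ε,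
    Category.id_comp]
  rfl

lemma actUnitIso_hom_comp_actMap_id_one_comp (A : Mon D) {N X : M} (a : actObj F A.X N ⟶ X) :
    (actUnitIso (𝟭 (Center M)) N).hom ≫ actMap (𝟭 (Center M)) η[(F.mapMon.obj A).X] N ≫ a =
      (actUnitIso F N).hom ≫ actMap F η[A.X] N ≫ a :=
  (Category.assoc _ _ _).symm.trans
    ((actUnitIso_hom_comp_actMap_id_one F A N =≫ a).trans (Category.assoc _ _ _))

lemma actUnitIso_hom_comp_actMap_one_comp_actMap {A A' : Mon D} (f : A ⟶ A') {N X : M}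
    (a : actObj F A'.X N ⟶ X) :
    (actUnitIso F N).hom ≫ actMap F η[A.X] N ≫ actMap F f.hom N ≫ a =
      (actUnitIso F N).hom ≫ actMap F η[A'.X] N ≫ a := by
  rw [← IsMonHom.one_hom f.hom, actMap_comp, Category.assoc]

variable {F} {A A' A'' Z Z' : Mon D} {N : Mon M}

namespace UnitalAction

@[ext]
lemma ext {t t' : UnitalAction F A N} (h : t.act.hom = t'.act.hom) : t = t' := by
  cases t
  cases t'
  congr
  exact Mon.Hom.ext h

/-- Actions of `A` through the braided functor `F` are the same as actions of the algebra `F A` in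
the Drinfeld center. -/
@[simps]
def equivCenter : UnitalAction F A N ≃ UnitalAction (𝟭 (Center M)) (F.mapMon.obj A) N where
  toFun t :=
    { act :=
        { hom := t.act.hom
          isMonHom_hom := (isMonHom_actAlg_id_mapMon_iff F A N t.act.hom).2 t.act.isMonHom_hom }
      unital := (actUnitIso_hom_comp_actMap_id_one_comp F A t.act.hom).trans t.unital }
  invFun t :=
    { act :=
        { hom := t.act.hom
          isMonHom_hom := (isMonHom_actAlg_id_mapMon_iff F A N t.act.hom).1 t.act.isMonHom_hom }
      unital := (actUnitIso_hom_comp_actMap_id_one_comp F A t.act.hom).symm.trans t.unital }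
  left_inv _ := rfl
  right_inv _ := rfl

/-- Restriction of an action along a homomorphism of algebras. -/
@[simps]
noncomputable def restrict (u : UnitalAction F A' N) (f : A ⟶ A') : UnitalAction F A N where
  act := actAlgMap F f N ≫ u.act
  unital := (actUnitIso_hom_comp_actMap_one_comp_actMap F f u.act.hom).trans u.unital

lemma restrict_id (u : UnitalAction F A N) : u.restrict (𝟙 A) = u := by
  ext
  rw [restrict_act, Mon.comp_hom']
  exact (actMap_id F A.X N.X =≫ u.act.hom).trans (Category.id_comp _)

lemma restrict_comp (u : UnitalAction F A'' N) (f : A ⟶ A') (g : A' ⟶ A'') :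
    u.restrict (f ≫ g) = (u.restrict g).restrict f := by
  ext
  exact (actMap_comp F f.hom g.hom N.X =≫ u.act.hom).trans (Category.assoc _ _ _)

lemma equivCenter_restrict (u : UnitalAction F A' N) (f : A ⟶ A') :
    equivCenter (u.restrict f) = (equivCenter u).restrict (F.mapMon.map f) :=
  rfl

end UnitalAction

lemma isLeftCenter_iff_existsUnique_restrict {u : UnitalAction F Z N} :
    IsLeftCenter F N Z u ↔
      ∀ (X : Mon D) (t : UnitalAction F X N), ∃! f : X ⟶ Z, u.restrict f = t := by
  simp only [UnitalAction.ext_iff]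
  rfl

lemma IsLeftCenter.nonempty_iso {u : UnitalAction F Z N} {u' : UnitalAction F Z' N}
    (h : IsLeftCenter F N Z u) (h' : IsLeftCenter F N Z' u') : Nonempty (Z ≅ Z') := by
  rw [isLeftCenter_iff_existsUnique_restrict] at h h'
  obtain ⟨f, hf, -⟩ := h' Z u
  obtain ⟨g, hg, -⟩ := h Z' u'
  refine ⟨f, g, (h Z u).unique ?_ u.restrict_id, (h' Z' u').unique ?_ u'.restrict_id⟩
  · rw [UnitalAction.restrict_comp, hg, hf]
  · rw [UnitalAction.restrict_comp, hf, hg]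

end Actions

/-! ### Left centers as intersections -/

section Intersections

lemma IsIntersection.nonempty_iso {E : Type u} [Category.{v} E] [MonoidalCategory E]
    {P : ObjectProperty E} {I I' Z : Mon E} {j : I ⟶ Z} {j' : I' ⟶ Z}
    (h : IsIntersection P j) (h' : IsIntersection P j') : Nonempty (I ≅ I') := by
  have := h.mono
  have := h'.mono
  obtain ⟨g, hg⟩ := h'.largest I.X j.hom h.mono h.mem
  obtain ⟨g', hg'⟩ := h.largest I'.X j'.hom h'.mono h'.mem
  have : IsMonHom g :=
    { one_hom := by
        rw [← cancel_mono j'.hom, Category.assoc, hg, IsMonHom.one_hom, IsMonHom.one_hom]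
      mul_hom := by
        rw [← cancel_mono j'.hom, Category.assoc, hg, Category.assoc, IsMonHom.mul_hom,
          IsMonHom.mul_hom, tensorHom_comp_tensorHom_assoc, hg] }
  have : IsIso g := ⟨g', by rw [← cancel_mono j.hom, Category.assoc, hg', hg, Category.id_comp],
    by rw [← cancel_mono j'.hom, Category.assoc, hg, hg', Category.id_comp]⟩
  exact ⟨Mon.mkIso' (asIso g)⟩

variable {D : Type u₁} [Category.{v₁} D] {E : Type u} [Category.{v} E]

lemma exists_comp_counit_eq_of_essImage {F : D ⥤ E} {G : E ⥤ D} (adj : F ⊣ G) {S Y : E}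
    (hS : F.essImage S) (s : S ⟶ Y) : ∃ g : S ⟶ F.obj (G.obj Y), g ≫ adj.counit.app Y = s := by
  obtain ⟨X, ⟨e⟩⟩ := hS
  exact ⟨e.inv ≫ F.map (adj.homEquiv X Y (e.hom ≫ s)), by simp [adj.homEquiv_unit]⟩

variable [MonoidalCategory D] [MonoidalCategory E]

lemma mapMon_counit_app_hom {F : D ⥤ E} [F.Monoidal] {G : E ⥤ D} [G.LaxMonoidal] (adj : F ⊣ G)
    [adj.IsMonoidal] (Z : Mon E) : (adj.mapMon.counit.app Z).hom = adj.counit.app Z.X :=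
  (Category.id_comp _).trans (Category.comp_id _)

lemma isIntersection_essImage_counit {F : D ⥤ E} [F.Monoidal] {G : E ⥤ D} [G.LaxMonoidal]
    (adj : F ⊣ G) [adj.IsMonoidal] (Z : Mon E) [Mono (adj.counit.app Z.X)] :
    IsIntersection F.essImage (adj.mapMon.counit.app Z) where
  mono := by rwa [mapMon_counit_app_hom]
  mem := F.obj_mem_essImage _
  largest S s _ hS := by
    rw [mapMon_counit_app_hom]
    exact exists_comp_counit_eq_of_essImage adj hS s

end Intersections

section FullCenter

variable {D : Type u₁} [Category.{v₁} D] [MonoidalCategory D] [BraidedCategory D]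
  {M : Type u} [Category.{v} M] [MonoidalCategory M] {F : D ⥤ Center M} [F.Braided]
  {G : Center M ⥤ D} [G.LaxMonoidal] (adj : F ⊣ G) [adj.IsMonoidal]
  {N : Mon M} {Z : Mon (Center M)} {u : UnitalAction (𝟭 (Center M)) Z N}

lemma IsFullCenter.isLeftCenter_mapMon_obj (hZ : IsFullCenter N Z u) :
    IsLeftCenter F N (G.mapMon.obj Z)
      (UnitalAction.equivCenter.symm (u.restrict (adj.mapMon.counit.app Z))) := by
  refine isLeftCenter_iff_existsUnique_restrict.2 fun A t => ?_
  have h := isLeftCenter_iff_existsUnique_restrict.1 hZ (F.mapMon.obj A)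
    (UnitalAction.equivCenter t)
  refine ((adj.mapMon.homEquiv A Z).symm.existsUnique_congr fun f => ?_).2 h
  rw [← UnitalAction.equivCenter.apply_eq_iff_eq, UnitalAction.equivCenter_restrict,
    Equiv.apply_symm_apply, ← UnitalAction.restrict_comp, Adjunction.homEquiv_counit]

theorem IsFullCenter.leftCenter_iso_intersection_essImage (hZ : IsFullCenter N Z u)
    [Mono (adj.counit.app Z.X)] :
    (∃ (I : Mon (Center M)) (j : I ⟶ Z), IsIntersection F.essImage j) ∧
      (∃ (Zl : Mon D) (ul : UnitalAction F Zl N), IsLeftCenter F N Zl ul) ∧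
      ∀ (I : Mon (Center M)) (j : I ⟶ Z), IsIntersection F.essImage j →
        ∀ (Zl : Mon D) (ul : UnitalAction F Zl N), IsLeftCenter F N Zl ul →
          Nonempty (F.mapMon.obj Zl ≅ I) := by
  have hI := isIntersection_essImage_counit adj Z
  have hL := hZ.isLeftCenter_mapMon_obj adj
  refine ⟨⟨_, _, hI⟩, ⟨_, _, hL⟩, fun I j hj Zl ul hl => ?_⟩
  obtain ⟨e⟩ := hl.nonempty_iso hL
  obtain ⟨e'⟩ := hI.nonempty_iso hj
  exact ⟨F.mapMon.mapIso e ≪≫ e'⟩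

end FullCenter

section Embeddings

variable {C : Type u} [Category.{v} C] [MonoidalCategory C] [BraidedCategory C]

lemma leftFactor_eq_essImage : leftFactor C = (leftEmbedding C).essImage := by
  have e (X : C) : boxProd X (𝟙_ (RevBraided C)) ≅ (leftEmbedding C).obj X :=
    whiskerLeftIso _ (Functor.Monoidal.εIso (rightEmbedding C)).symm ≪≫ ρ_ _
  ext W
  exact exists_congr fun X =>
    ⟨fun ⟨a⟩ => ⟨(a ≪≫ e X).symm⟩, fun ⟨a⟩ => ⟨a.symm ≪≫ (e X).symm⟩⟩

lemma rightFactor_eq_essImage : rightFactor C = (rightEmbedding C).essImage := by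
  have e (Y : RevBraided C) : boxProd (𝟙_ C) Y ≅ (rightEmbedding C).obj Y :=
    whiskerRightIso (Functor.Monoidal.εIso (leftEmbedding C)).symm _ ≪≫ λ_ _
  ext W
  exact exists_congr fun Y =>
    ⟨fun ⟨a⟩ => ⟨(a ≪≫ e Y).symm⟩, fun ⟨a⟩ => ⟨a.symm ≪≫ (e Y).symm⟩⟩

end Embeddings

theorem mainTheorem6_general {C : Type u} [Category.{v} C] [MonoidalCategory C]
    [BraidedCategory C] [MonoidalClosed C] [HasEqualizers C] [HasPullbacks C]
    [∀ X : C, IsArtinianObject X] (B : Mon C)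
    (Z : Mon (Center C)) (u : UnitalAction (𝟭 (Center C)) Z B) (hZ : IsFullCenter B Z u) :
    ((∃ (I : Mon (Center C)) (j : I ⟶ Z), IsIntersection (leftFactor C) j) ∧
      (∃ (Zl : Mon C) (ul : UnitalAction (leftEmbedding C) Zl B),
        IsLeftCenter (leftEmbedding C) B Zl ul) ∧
      ∀ (I : Mon (Center C)) (j : I ⟶ Z), IsIntersection (leftFactor C) j →
        ∀ (Zl : Mon C) (ul : UnitalAction (leftEmbedding C) Zl B),
          IsLeftCenter (leftEmbedding C) B Zl ul →
            Nonempty ((leftEmbedding C).mapMon.obj Zl ≅ I)) ∧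
    ((∃ (I : Mon (Center C)) (j : I ⟶ Z), IsIntersection (rightFactor C) j) ∧
      (∃ (Zr : Mon (RevBraided C)) (ur : UnitalAction (rightEmbedding C) Zr B),
        IsLeftCenter (rightEmbedding C) B Zr ur) ∧
      ∀ (I : Mon (Center C)) (j : I ⟶ Z), IsIntersection (rightFactor C) j →
        ∀ (Zr : Mon (RevBraided C)) (ur : UnitalAction (rightEmbedding C) Zr B),
          IsLeftCenter (rightEmbedding C) B Zr ur →
            Nonempty ((rightEmbedding C).mapMon.obj Zr ≅ I)) := by
  obtain ⟨_, adjLeft, _⟩ := exists_leftEmbedding_adjunction (C := C)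
  obtain ⟨_, adjRight, _⟩ := exists_rightEmbedding_adjunction (C := C)
  let := adjLeft.rightAdjointLaxMonoidal
  let := adjRight.rightAdjointLaxMonoidal
  rw [leftFactor_eq_essImage, rightFactor_eq_essImage]
  exact ⟨hZ.leftCenter_iso_intersection_essImage adjLeft,
    hZ.leftCenter_iso_intersection_essImage adjRight⟩

theorem mainTheorem6 {C : Type u} [Category.{v} C] [Abelian C] [Linear ℂ C]
    [MonoidalCategory C] [MonoidalPreadditive C] [MonoidalLinear ℂ C] [RigidCategory C]
    [BraidedCategory C] [ModularTensorCategory C]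
    (B : Mon C) (hB : IsCondensableAlg B)
    (Z : Mon (Center C)) (u : UnitalAction (𝟭 (Center C)) Z B) (hZ : IsFullCenter B Z u) :
    ((∃ (I : Mon (Center C)) (j : I ⟶ Z), IsIntersection (leftFactor C) j) ∧
      (∃ (Zl : Mon C) (ul : UnitalAction (leftEmbedding C) Zl B),
        IsLeftCenter (leftEmbedding C) B Zl ul) ∧
      ∀ (I : Mon (Center C)) (j : I ⟶ Z), IsIntersection (leftFactor C) j →
        ∀ (Zl : Mon C) (ul : UnitalAction (leftEmbedding C) Zl B),
          IsLeftCenter (leftEmbedding C) B Zl ul →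
            Nonempty ((leftEmbedding C).mapMon.obj Zl ≅ I)) ∧
    ((∃ (I : Mon (Center C)) (j : I ⟶ Z), IsIntersection (rightFactor C) j) ∧
      (∃ (Zr : Mon (RevBraided C)) (ur : UnitalAction (rightEmbedding C) Zr B),
        IsLeftCenter (rightEmbedding C) B Zr ur) ∧
      ∀ (I : Mon (Center C)) (j : I ⟶ Z), IsIntersection (rightFactor C) j →
        ∀ (Zr : Mon (RevBraided C)) (ur : UnitalAction (rightEmbedding C) Zr B),
          IsLeftCenter (rightEmbedding C) B Zr ur →
            Nonempty ((rightEmbedding C).mapMon.obj Zr ≅ I)) := by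
  let := monoidalClosedOfLeftRigidCategory C
  have (X : C) : IsArtinianObject X := ModularTensorCategory.isArtinianObject X
  exact mainTheorem6_general B Z u hZ
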